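/- For a finite connected graph $G$ with at least one edge, let $m_{i,j}$ denote the expected number of steps the simple random walk on $G$ takes to reach vertex $j$ for the first time when it starts at vertex $i$, let $\pi_i = \deg_G(i)/(2|E(G)|)$ be its stationary distribution, and let $$\kappa(G)=\sum_{i}\sum_{j\neq i}\pi_i\, m_{i,j}\,\pi_j$$ be Kemeny's constant of $G$. A vertex $v$ of a tree $T$ on $n$ vertices is called a centroid of $T$ if every connected component of $T-v$ has at most $\lfloor n/2\rfloor$ vertices. Let $T_1$ and $T_2$ be finite trees. For $v_1\in V(T_1)$ and $v_2\in V(T_2)$, let $G_{v_1,v_2}$ be the graph formed from the disjoint union of $T_1$ and $T_2$ by adding the edge $v_1\sim v_2$. Then for all $v_1\in V(T_1)$ and $v_2\in V(T_2)$, $$\kappa(G_{v_1,v_2})=\min_{u_1\in V(T_1),\,u_2\in V(T_2)}\kappa(G_{u_1,u_2})$$ if and only if $v_1$ is a centroid of $T_1$ and $v_2$ is a centroid of $T_2$. -/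

import Mathlib

open scoped ENNReal

namespace KemenyTree

section MarkovChain

variable {V : Type*} [Fintype V]

open Classical in
/-- For a Markov chain with transition matrix `P` on the finite state space `V`, the probability
that the chain started in state `i` visits state `j` for the first time at time `k`: the sum, over
all trajectories `ω` of `k` steps which start in `i`, end in `j` and are not in `j` at any earlier
time, of the probability of the trajectory. -/
noncomputable def firstPassageProb (P : Matrix V V ℝ≥0∞) (i j : V) (k : ℕ) : ℝ≥0∞ :=
  ∑ ω : Fin (k + 1) → V,
    if ω 0 = i ∧ ω (Fin.last k) = j ∧ ∀ t : Fin k, ω t.castSucc ≠ j then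
      ∏ t : Fin k, P (ω t.castSucc) (ω t.succ)
    else 0

/-- The mean first passage time from `i` to `j`: the expected number of steps until a chain that
starts in `i` reaches `j` for the first time. It is used only for irreducible chains on a
finite state space, where `j` is reached with probability one. -/
noncomputable def meanFirstPassageTime (P : Matrix V V ℝ≥0∞) (i j : V) : ℝ≥0∞ :=
  ∑' k : ℕ, (k : ℝ≥0∞) * firstPassageProb P i j k

open Classical in
/-- Kemeny's constant of the chain with transition matrix `P` and stationary distribution `π`. -/
noncomputable def kemenyConstant (P : Matrix V V ℝ≥0∞) (π : V → ℝ≥0∞) : ℝ≥0∞ :=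
  ∑ i, ∑ j ∈ Finset.univ.erase i, π i * meanFirstPassageTime P i j * π j

end MarkovChain

section RandomWalk

variable {V : Type*} [Fintype V]

open Classical in
/-- The transition matrix of the simple random walk on `G`. -/
noncomputable def transitionMatrix (G : SimpleGraph V) : Matrix V V ℝ≥0∞ :=
  fun i j => if G.Adj i j then ((G.degree i : ℕ) : ℝ≥0∞)⁻¹ else 0

open Classical in
/-- The stationary distribution `deg(i) / (2 |E(G)|)` of the simple random walk on a connected
graph `G` (see `sum_stationary` and `stationary_vecMul`). -/
noncomputable def stationary (G : SimpleGraph V) : V → ℝ≥0∞ :=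
  fun i => ((G.degree i : ℕ) : ℝ≥0∞) / (2 * (G.edgeFinset.card : ℕ))

/-- Kemeny's constant `κ(G)` of the simple random walk on `G`. -/
noncomputable def kappa (G : SimpleGraph V) : ℝ≥0∞ :=
  kemenyConstant (transitionMatrix G) (stationary G)

theorem sum_stationary (G : SimpleGraph V) (hG : G ≠ ⊥) : ∑ i, stationary G i = 1 := by
  classical
  have hE : G.edgeFinset.card ≠ 0 := by
    simpa [SimpleGraph.edgeFinset_eq_empty] using hG
  have h := G.sum_degrees_eq_twice_card_edges
  simp only [stationary, div_eq_mul_inv, ← Finset.sum_mul]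
  rw [← Nat.cast_sum]
  have h2 : ((∑ i, G.degree i : ℕ) : ℝ≥0∞) = 2 * (G.edgeFinset.card : ℕ) := by
    rw [h]; push_cast; rfl
  have h3 := ENNReal.mul_inv_cancel (a := 2 * (G.edgeFinset.card : ℝ≥0∞))
    (mul_ne_zero (by simp) (Nat.cast_ne_zero.2 hE)) (ENNReal.mul_ne_top (by simp) (by simp))
  rw [← h3, ← h2]

theorem stationary_vecMul (G : SimpleGraph V) :
    Matrix.vecMul (stationary G) (transitionMatrix G) = stationary G := by
  classical
  funext j
  simp only [Matrix.vecMul, dotProduct, stationary, transitionMatrix]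
  have key : ∀ i, ((G.degree i : ℕ) : ℝ≥0∞) / (2 * (G.edgeFinset.card : ℕ)) *
      (if G.Adj i j then ((G.degree i : ℕ) : ℝ≥0∞)⁻¹ else 0) =
      (if G.Adj j i then 1 else 0) * (2 * (G.edgeFinset.card : ℝ≥0∞))⁻¹ := by
    intro i
    by_cases hij : G.Adj i j
    · have hd : ((G.degree i : ℕ) : ℝ≥0∞) ≠ 0 := by
        have := (G.degree_pos_iff_exists_adj i).2 ⟨j, hij⟩
        exact_mod_cast this.ne'
      rw [if_pos hij, if_pos hij.symm, div_eq_mul_inv, mul_right_comm,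
        ENNReal.mul_inv_cancel hd (by simp)]
    · rw [if_neg hij, if_neg (fun h => hij h.symm)]; simp
  have hs : ∑ i, (if G.Adj j i then (1 : ℝ≥0∞) else 0) = ((G.degree j : ℕ) : ℝ≥0∞) := by
    rw [Finset.sum_boole, ← SimpleGraph.card_neighborFinset_eq_degree,
      SimpleGraph.neighborFinset_eq_filter]
  rw [div_eq_mul_inv]
  convert (Finset.sum_congr rfl fun i _ => key i).trans ?_
  rw [← Finset.sum_mul, hs]

end RandomWalk

/-- `v` is a centroid of the tree `T` on `n` vertices: every component of `T - v` has at most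
`⌊n / 2⌋` vertices. -/
def IsCentroid {V : Type*} [Fintype V] (T : SimpleGraph V) (v : V) : Prop :=
  ∀ c : (T.induce {v}ᶜ).ConnectedComponent, c.supp.ncard ≤ Fintype.card V / 2

/-- The graph formed from the disjoint union of `T₁` and `T₂` by adding the edge `v₁ ~ v₂`. -/
def joinByEdge {V₁ V₂ : Type*} (T₁ : SimpleGraph V₁) (T₂ : SimpleGraph V₂) (v₁ : V₁) (v₂ : V₂) :
    SimpleGraph (V₁ ⊕ V₂) :=
  (T₁ ⊕g T₂) ⊔ SimpleGraph.edge (Sum.inl v₁) (Sum.inr v₂)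

end KemenyTree

/-! On a tree the distance `ρ` plays the role of effective resistance, and `m i j = ∑ x, deg x * (ρ
i j + ρ j x - ρ i x) / 2`. Averaging over the stationary distribution gives `κ = (∑ i j, deg i * deg
j * ρ i j) / (2 * ∑ deg)` (`kappa_eq_of_laplacian`).

In the joined tree every path between the two sides uses the bridge, so the double sum splits: apart
from terms independent of the chosen vertices, it is `2 (S₂ + 2) D₁(v₁) + 2 (S₁ + 2) D₂(v₂)`, with
`S` the degree sum of a tree and `D` its degree-weighted distance sum. The denominator is fixed and
the coefficients are positive, so `v₁` and `v₂` must minimise `D₁` and `D₂` separately.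

On a tree `D` is twice the plain distance sum plus a constant, by Green's identity. The distance sum
changes by `n - 2b` across an edge leading into a branch with `b` vertices, and it is convex along
paths. Its minimisers are therefore its local minimisers, which are the centroids. -/

namespace KemenyTree

/-! ### First passage times and the first-step equations. -/

section FirstPassage

open Classical in
/-- The operator `u ↦ P u`, killed at the target state `j`. -/
noncomputable def killedStep {V : Type*} [Fintype V] (P : Matrix V V ℝ≥0∞) (j : V)
    (u : V → ℝ≥0∞) : V → ℝ≥0∞ :=
  fun i => if i = j then 0 else ∑ l, P i l * u l

variable {V : Type*} [Fintype V] {P : Matrix V V ℝ≥0∞} {j : V}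

theorem firstPassageProb_zero (i : V) [Decidable (i = j)] :
    firstPassageProb P i j 0 = if i = j then 1 else 0 := by
  classical
  unfold firstPassageProb
  rw [Fintype.sum_eq_single (fun _ => i)]
  · simp
  · intro ω hω
    rw [if_neg]
    rintro ⟨h, -⟩
    apply hω
    funext t
    obtain rfl : t = 0 := Fin.fin_one_eq_zero t
    exact h

/-- Condition on the first step: a trajectory is its initial state followed by a trajectory that is
one step shorter. Starting in `j` rules out a first visit at a positive time. -/
theorem firstPassageProb_succ (k : ℕ) :
    (fun i => firstPassageProb P i j (k + 1)) =
      killedStep P j (fun i => firstPassageProb P i j k) := by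
  classical
  funext i
  unfold firstPassageProb killedStep
  rw [← (Fin.consEquiv (fun _ : Fin (k + 2) => V)).sum_comp, Fintype.sum_prod_type]
  rw [Fintype.sum_eq_single i]
  · by_cases hij : i = j
    · rw [if_pos hij]
      refine Finset.sum_eq_zero fun ω _ => if_neg ?_
      rintro ⟨-, -, h⟩
      exact h 0 (by simpa [Fin.consEquiv] using hij)
    · rw [if_neg hij]
      simp_rw [Finset.mul_sum]
      rw [Finset.sum_comm]
      refine Finset.sum_congr rfl fun ω _ => ?_
      rw [Fintype.sum_eq_single (ω 0)]
      · have hiff : (∀ t : Fin (k + 1), (Fin.cons i ω : Fin (k + 2) → V) t.castSucc ≠ j) ↔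
            ∀ t : Fin k, ω t.castSucc ≠ j := by
          rw [Fin.forall_fin_succ]
          simp [hij]
        simp only [Fin.consEquiv, Equiv.coe_fn_mk, Fin.cons_zero, true_and, hiff,
          ← Fin.succ_last, Fin.cons_succ, Fin.prod_univ_succ, Fin.castSucc_zero,
          ← Fin.succ_castSucc, mul_ite, mul_zero]
      · intro l hl
        rw [if_neg (fun h => hl h.1.symm), mul_zero]
  · intro l hl
    refine Finset.sum_eq_zero fun ω _ => if_neg ?_
    rintro ⟨h, -⟩
    exact hl (by simpa [Fin.consEquiv] using h)

theorem killedStep_add (u w : V → ℝ≥0∞) :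
    killedStep P j (u + w) = killedStep P j u + killedStep P j w := by
  funext i
  by_cases h : i = j <;> simp [killedStep, h, mul_add, Finset.sum_add_distrib]

theorem killedStep_const_mul (c : ℝ≥0∞) (u : V → ℝ≥0∞) :
    killedStep P j (fun i => c * u i) = fun i => c * killedStep P j u i := by
  funext i
  by_cases h : i = j <;> simp [killedStep, h, Finset.mul_sum, mul_left_comm]

theorem killedStep_mono : Monotone (killedStep P j) := by
  intro u w h i
  by_cases hi : i = j
  · simp [killedStep, hi]
  · simp only [killedStep, hi, if_false]
    gcongr with l
    exact h l

open Classical in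
/-- The probability that the chain started at `i` is not in `j` at any of the times `0, …, t`. -/
noncomputable def survivalProb (P : Matrix V V ℝ≥0∞) (j : V) (t : ℕ) : V → ℝ≥0∞ :=
  (killedStep P j)^[t] (fun i => if i = j then 0 else 1)

theorem survivalProb_succ (t : ℕ) :
    survivalProb P j (t + 1) = killedStep P j (survivalProb P j t) :=
  Function.iterate_succ_apply' _ _ _

/-- A chain that has avoided `j` up to time `t` either avoids it at time `t + 1` too or hits it
then. The case `t = 0` is the row-sum condition; linearity of the killed operator propagates it. -/
theorem survivalProb_eq_add (hP : ∀ i, i ≠ j → ∑ l, P i l = 1) (t : ℕ) :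
    survivalProb P j t =
      survivalProb P j (t + 1) + fun i => firstPassageProb P i j (t + 1) := by
  classical
  induction t with
  | zero =>
    rw [survivalProb_succ, firstPassageProb_succ, ← killedStep_add]
    funext i
    by_cases hi : i = j
    · simp [survivalProb, killedStep, hi]
    · simp only [survivalProb, Function.iterate_zero, id, killedStep, hi, if_false,
        firstPassageProb_zero, Pi.add_apply]
      refine (hP i hi).symm.trans (Finset.sum_congr rfl fun l _ => ?_)
      by_cases hl : l = j <;> simp [hl]
  | succ t ih =>
    rw [survivalProb_succ, survivalProb_succ (t + 1), firstPassageProb_succ, ← killedStep_add,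
      ← ih]

/-- Write `k` as the number of `t < k` and interchange the sums. -/
theorem tsum_nat_mul_eq_tsum_tail (a : ℕ → ℝ≥0∞) :
    ∑' k : ℕ, (k : ℝ≥0∞) * a k = ∑' t, ∑' k, a (t + 1 + k) := by
  have hind : ∀ t, ∑' k, a (t + 1 + k) = ∑' k, if t < k then a k else 0 := by
    intro t
    have h := Summable.sum_add_tsum_nat_add' (f := fun k => if t < k then a k else 0)
      (k := t + 1) ENNReal.summable
    rw [← h, Finset.sum_eq_zero, zero_add]
    · refine tsum_congr fun k => ?_
      rw [if_pos (by omega), add_comm]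
    · intro k hk
      rw [if_neg]
      have := Finset.mem_range.1 hk
      omega
  simp_rw [hind]
  rw [ENNReal.tsum_comm]
  refine tsum_congr fun k => ?_
  rw [tsum_eq_sum (s := Finset.range k)]
  · rw [Finset.sum_congr rfl fun t ht => if_pos (Finset.mem_range.1 ht)]
    simp
  · intro t ht
    exact if_neg (by simpa using ht)

/-- Uniqueness of the finite solution of the first-step equations. Iterating them writes `g` as a
partial sum of survival probabilities plus a remainder. Finiteness of `g` makes the survival
probabilities summable, hence null, so no separate recurrence argument is required. -/
theorem meanFirstPassageTime_eq_of_step (hP : ∀ i, i ≠ j → ∑ l, P i l = 1)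
    {g : V → ℝ≥0∞} (hfin : ∀ i, g i ≠ ∞) (hj : g j = 0)
    (hstep : ∀ i, i ≠ j → g i = 1 + ∑ l, P i l * g l) (i : V) :
    meanFirstPassageTime P i j = g i := by
  classical
  set S := survivalProb P j with hS
  have hg : g = S 0 + killedStep P j g := by
    funext l
    by_cases hl : l = j
    · simp [hS, survivalProb, killedStep, hl, hj]
    · simpa [hS, survivalProb, killedStep, hl] using hstep l hl
  have hsum : ∀ n : ℕ, g = (∑ t ∈ Finset.range n, S t) + (killedStep P j)^[n] g := by
    intro n
    induction n with
    | zero => simp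
    | succ n ih =>
      have hS' : S n = (killedStep P j)^[n] (S 0) := rfl
      have hadd : ∀ (m : ℕ) (u w : V → ℝ≥0∞), (killedStep P j)^[m] (u + w) =
          (killedStep P j)^[m] u + (killedStep P j)^[m] w := by
        intro m
        induction m with
        | zero => simp
        | succ m ihm => intro u w; simp only [Function.iterate_succ_apply, killedStep_add, ihm]
      rw [Finset.sum_range_succ, add_assoc, hS', Function.iterate_succ_apply, ← hadd, ← hg]
      exact ih
  have hle : ∑' t, S t i ≤ g i := by
    rw [ENNReal.tsum_eq_iSup_nat]
    refine iSup_le fun n => ?_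
    have := congrFun (hsum n) i
    rw [this]
    simp
  have hne : ∑' t, S t i ≠ ∞ := ne_top_of_le_ne_top (hfin i) hle
  have hS0 : Filter.Tendsto (fun t => S t i) Filter.atTop (nhds 0) :=
    ENNReal.tendsto_atTop_zero_of_tsum_ne_top hne
  set C := ∑ l, g l with hC
  have hCfin : C ≠ ∞ := ENNReal.sum_ne_top.2 fun l _ => hfin l
  -- Since `g` vanishes at `j` and is at most `C` elsewhere, `g ≤ C * S 0`; the monotone killed
  -- operator carries this bound to every `n`.
  have hrem : ∀ n, (killedStep P j)^[n] g ≤ fun l => C * S n l := by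
    intro n
    induction n with
    | zero =>
      intro l
      by_cases hl : l = j
      · simp [hl, hj]
      · simpa [hS, survivalProb, hl] using
          Finset.single_le_sum (f := g) (fun _ _ => zero_le) (Finset.mem_univ l)
    | succ n ih =>
      rw [Function.iterate_succ_apply']
      refine (killedStep_mono ih).trans ?_
      rw [killedStep_const_mul, hS, survivalProb_succ]
  have hgi : g i = ∑' t, S t i := by
    refine le_antisymm ?_ hle
    have hlim : Filter.Tendsto (fun n => ∑' t, S t i + C * S n i) Filter.atTop
        (nhds (∑' t, S t i + C * 0)) :=
      tendsto_const_nhds.add (ENNReal.Tendsto.const_mul hS0 (Or.inr hCfin))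
    rw [mul_zero, add_zero] at hlim
    refine ge_of_tendsto' hlim fun n => ?_
    have h1 := congrFun (hsum n) i
    rw [h1, Pi.add_apply, Finset.sum_apply]
    exact add_le_add (ENNReal.sum_le_tsum _) (hrem n i)
  have htail : ∀ t, S t i = ∑' k, firstPassageProb P i j (t + 1 + k) := by
    intro t
    have hpart : ∀ n, S t i =
        (∑ k ∈ Finset.range n, firstPassageProb P i j (t + 1 + k)) + S (t + n) i := by
      intro n
      induction n with
      | zero => simp
      | succ n ih =>
        have := congrFun (survivalProb_eq_add (P := P) (j := j) hP (t + n)) i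
        rw [Finset.sum_range_succ, ih, add_assoc]
        congr 1
        rw [hS, this, Pi.add_apply, add_comm, add_right_comm t n 1, ← add_assoc t n 1,
          add_right_comm t n 1]
    have h1 := ENNReal.summable.hasSum.tendsto_sum_nat
      (f := fun k => firstPassageProb P i j (t + 1 + k))
    have h2 : Filter.Tendsto (fun n => S (t + n) i) Filter.atTop (nhds 0) := by
      simp_rw [add_comm t]
      exact hS0.comp (Filter.tendsto_add_atTop_nat t)
    have h3 := h1.add h2
    simp_rw [← hpart, add_zero] at h3
    exact tendsto_nhds_unique tendsto_const_nhds h3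
  rw [hgi, meanFirstPassageTime, tsum_nat_mul_eq_tsum_tail]
  exact tsum_congr fun t => (htail t).symm

end FirstPassage

end KemenyTree
namespace KemenyTree

/-! ### The Laplacian of the distance function of a tree. -/

section Tree

open Classical in
/-- The Laplacian of `G` applied to `f`, evaluated at `i`. -/
noncomputable def laplacian {V : Type*} [Fintype V] (G : SimpleGraph V) (f : V → ℝ) (i : V) : ℝ :=
  ∑ l, if G.Adj i l then f i - f l else 0

open Classical in
/-- The real-valued degree. -/
noncomputable def realDegree {V : Type*} [Fintype V] (G : SimpleGraph V) (i : V) : ℝ :=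
  ∑ l, if G.Adj i l then 1 else 0

theorem sum_mul_laplacian_comm {V : Type*} [Fintype V] (G : SimpleGraph V) (f g : V → ℝ) :
    ∑ i, f i * laplacian G g i = ∑ i, g i * laplacian G f i := by
  classical
  have key : ∀ f g : V → ℝ, ∑ i, f i * laplacian G g i =
      ∑ i, f i * g i * realDegree G i - ∑ i, ∑ l, if G.Adj i l then f i * g l else 0 := by
    intro f g
    rw [← Finset.sum_sub_distrib]
    refine Finset.sum_congr rfl fun i _ => ?_
    rw [laplacian, realDegree, Finset.mul_sum, Finset.mul_sum, ← Finset.sum_sub_distrib]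
    refine Finset.sum_congr rfl fun l _ => ?_
    split_ifs <;> ring
  rw [key, key, Finset.sum_comm (f := fun i l => if G.Adj i l then f i * g l else 0)]
  congr 1
  · exact Finset.sum_congr rfl fun i _ => by ring
  · refine Finset.sum_congr rfl fun i _ => Finset.sum_congr rfl fun l _ => ?_
    simp only [G.adj_comm l i, mul_comm]

variable {V : Type*} {T : SimpleGraph V}

theorem exists_adj_dist_add_one (hT : T.Connected) {x u : V} (hx : x ≠ u) :
    ∃ w, T.Adj x w ∧ T.dist w u + 1 = T.dist x u := by
  obtain ⟨p, hp⟩ := hT.exists_walk_length_eq_dist x u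
  cases p with
  | nil => exact absurd rfl hx
  | @cons _ w _ h q =>
    refine ⟨w, h, ?_⟩
    rw [SimpleGraph.Walk.length_cons] at hp
    have h1 := T.dist_le q
    have h2 := hT.dist_triangle (u := x) (v := w) (w := u)
    rw [SimpleGraph.dist_eq_one_iff_adj.2 h] at h2
    omega

/-- Both neighbours begin geodesics from `x` to `u`, and paths in a tree are unique. -/
theorem eq_of_adj_of_dist_add_one (hT : T.IsTree) {x u w w' : V} (hw : T.Adj x w)
    (hw' : T.Adj x w') (h : T.dist w u + 1 = T.dist x u) (h' : T.dist w' u + 1 = T.dist x u) :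
    w = w' := by
  obtain ⟨p, hp⟩ := hT.connected.exists_walk_length_eq_dist w u
  obtain ⟨q, hq⟩ := hT.connected.exists_walk_length_eq_dist w' u
  have h1 : (SimpleGraph.Walk.cons hw p).IsPath :=
    SimpleGraph.Walk.isPath_of_length_eq_dist _ (by simp [hp, h])
  have h2 : (SimpleGraph.Walk.cons hw' q).IsPath :=
    SimpleGraph.Walk.isPath_of_length_eq_dist _ (by simp [hq, h'])
  have h3 := (hT.existsUnique_path x u).unique h1 h2
  simpa using congrArg SimpleGraph.Walk.snd h3

theorem dist_adj_cases (hT : T.IsTree) (u : V) {x y : V} (h : T.Adj x y) :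
    T.dist x u = T.dist y u + 1 ∨ T.dist y u = T.dist x u + 1 := by
  rw [T.dist_comm (u := x), T.dist_comm (u := y)]
  exact hT.dist_eq_dist_add_one_of_adj u h

/-- Away from `x`, exactly one neighbour is closer to `x` and the other `deg - 1` are farther,
giving `1 - (deg - 1)`. At `x` all neighbours are farther, giving `-deg`. -/
theorem laplacian_dist [Fintype V] [DecidableEq V] (hT : T.IsTree) (x i : V) :
    laplacian T (fun l => (T.dist l x : ℝ)) i =
      2 - realDegree T i - 2 * (if i = x then 1 else 0) := by
  classical
  rw [laplacian, realDegree]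
  by_cases hi : i = x
  · subst hi
    simp only [if_true]
    have : ∀ l, (if T.Adj i l then ((T.dist i i : ℕ) : ℝ) - (T.dist l i : ℝ) else 0) =
        - if T.Adj i l then 1 else 0 := by
      intro l
      split_ifs with h
      · rw [T.dist_self, SimpleGraph.dist_eq_one_iff_adj.2 h.symm]; simp
      · simp
    rw [Finset.sum_congr rfl fun l _ => this l, Finset.sum_neg_distrib]
    ring
  · obtain ⟨w, hw, hd⟩ := exists_adj_dist_add_one hT.connected hi
    have : ∀ l, (if T.Adj i l then ((T.dist i x : ℕ) : ℝ) - (T.dist l x : ℝ) else 0) =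
        2 * (if l = w then 1 else 0) - if T.Adj i l then 1 else 0 := by
      intro l
      split_ifs with h h2 h2
      · subst h2; rw [← hd]; push_cast; ring
      · rcases dist_adj_cases hT x h with h3 | h3
        · exact absurd (eq_of_adj_of_dist_add_one hT h hw h3.symm hd) h2
        · rw [h3]; push_cast; ring
      · subst h2; exact absurd hw h
      · ring
    rw [Finset.sum_congr rfl fun l _ => this l, Finset.sum_sub_distrib, ← Finset.mul_sum]
    simp [hi]

/-! ### Distance sums and their minimisers. -/

/-- The sum of the distances to `x`. -/
noncomputable def transmission [Fintype V] (T : SimpleGraph V) (x : V) : ℝ := ∑ i, (T.dist i x : ℝ)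

/-- The sum of the distances to `x`, weighted by the degrees. -/
noncomputable def degreeTransmission [Fintype V] (T : SimpleGraph V) (x : V) : ℝ :=
  ∑ i, realDegree T i * (T.dist i x : ℝ)

/-- Green's identity for the distances to `x` and to `y`: the point masses contribute the same `2 *
dist x y` to both sides and cancel. -/
theorem degreeTransmission_sub [Fintype V] (hT : T.IsTree) (x y : V) :
    degreeTransmission T x - degreeTransmission T y =
      2 * (transmission T x - transmission T y) := by
  classical
  have key : ∀ x y, ∑ i, (T.dist i x : ℝ) * laplacian T (fun l => (T.dist l y : ℝ)) i =
      2 * transmission T x - degreeTransmission T x - 2 * T.dist y x := by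
    intro x y
    simp only [laplacian_dist hT, mul_sub, Finset.sum_sub_distrib, transmission,
      degreeTransmission, Finset.mul_sum]
    congr 1
    · congr 1 <;> exact Finset.sum_congr rfl fun i _ => by ring
    · simp [mul_comm]
  have h := sum_mul_laplacian_comm T (fun l => (T.dist l x : ℝ)) (fun l => (T.dist l y : ℝ))
  rw [key, key, T.dist_comm] at h
  linarith

/-- The inequality holds termwise: at most one of `x`, `y` is closer to `i` than `w` is, and the
other is farther by one. -/
theorem transmission_convex [Fintype V] (hT : T.IsTree) {w x y : V} (hx : T.Adj w x) (hy : T.Adj w y)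
    (hxy : x ≠ y) : 2 * transmission T w ≤ transmission T x + transmission T y := by
  rw [transmission, transmission, transmission, Finset.mul_sum, ← Finset.sum_add_distrib]
  refine Finset.sum_le_sum fun i _ => ?_
  rw [T.dist_comm (u := i) (v := w), T.dist_comm (u := i) (v := x), T.dist_comm (u := i) (v := y)]
  rcases dist_adj_cases hT i hx with h | h <;> rcases dist_adj_cases hT i hy with h' | h'
  · exact absurd (eq_of_adj_of_dist_add_one hT hx hy h.symm h'.symm) hxy
  all_goals norm_cast; omega

/-- By convexity, a step toward `v` that does not increase the transmission forces the same for the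
step before it. The hypothesis covers the last step of every geodesic to `v`. -/
theorem transmission_le_of_forall_adj [Fintype V] (hT : T.IsTree) {v : V}
    (hv : ∀ w, T.Adj v w → transmission T v ≤ transmission T w) (u : V) :
    transmission T v ≤ transmission T u := by
  have step : ∀ k : ℕ, ∀ z z', T.Adj z z' → T.dist z' v = k → T.dist z v = k + 1 →
      transmission T z' ≤ transmission T z := by
    intro k
    induction k with
    | zero =>
      intro z z' h h0 _
      obtain rfl := hT.connected.dist_eq_zero_iff.1 h0
      exact hv z h.symm
    | succ k ih =>
      intro z z' h h0 h1
      have hne : z' ≠ v := by rintro rfl; simp at h0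
      obtain ⟨y, hy, hyd⟩ := exists_adj_dist_add_one hT.connected hne
      have h2 := ih z' y hy (by omega) h0
      have h3 := transmission_convex hT hy h.symm (by rintro rfl; omega)
      linarith
  obtain ⟨k, hk⟩ : ∃ k, T.dist u v = k := ⟨_, rfl⟩
  induction k generalizing u with
  | zero => rw [hT.connected.dist_eq_zero_iff.1 hk]
  | succ k ih =>
    have hne : u ≠ v := by rintro rfl; simp at hk
    obtain ⟨y, hy, hyd⟩ := exists_adj_dist_add_one hT.connected hne
    exact (ih y (by omega)).trans (step k u y hy (by omega) hk)

/-! ### Branches and centroids. -/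

/-- The vertices which are closer to `w` than to `v`. -/
def branch (T : SimpleGraph V) (v w : V) : Set V := {x | T.dist x w < T.dist x v}

theorem mem_branch {v w x : V} : x ∈ branch T v w ↔ T.dist x w < T.dist x v := Iff.rfl

/-- Moving from `v` to `w` shortens the distance by one for the vertices of the branch and lengthens
it by one for all others. -/
theorem transmission_sub_of_adj [Fintype V] (hT : T.IsTree) {v w : V} (h : T.Adj v w) :
    transmission T w - transmission T v = Fintype.card V - 2 * ((branch T v w).ncard : ℝ) := by
  classical
  have hc : ((branch T v w).ncard : ℝ) = ∑ x, if x ∈ branch T v w then (1 : ℝ) else 0 := by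
    rw [Finset.sum_boole, Set.ncard_eq_toFinset_card']
    congr 2
    ext x
    simp
  have hn : (Fintype.card V : ℝ) = ∑ _x : V, (1 : ℝ) := by simp
  rw [hc, hn, Finset.mul_sum, transmission, transmission, ← Finset.sum_sub_distrib,
    ← Finset.sum_sub_distrib]
  refine Finset.sum_congr rfl fun x _ => ?_
  rcases hT.dist_eq_dist_add_one_of_adj x h with h1 | h1
  · rw [if_pos (show x ∈ branch T v w from mem_branch.2 (by omega)), h1]; push_cast; ring
  · rw [if_neg (show x ∉ branch T v w from fun hx => absurd (mem_branch.1 hx) (by omega)), h1]; push_cast; ring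

/-- An edge leaving the branch at `x` would lead to the neighbour of `x` closer to `v`. For `x ≠ w`
that is also the neighbour closer to `w`, which lies in the branch; for `x = w` it is `v`. -/
theorem mem_branch_of_adj (hT : T.IsTree) {v w x y : V} (hvw : T.Adj v w) (hxy : T.Adj x y)
    (hy : y ≠ v) (hx : x ∈ branch T v w) : y ∈ branch T v w := by
  simp only [mem_branch] at hx ⊢
  by_contra hcon
  have h1 := hT.dist_eq_dist_add_one_of_adj x hvw
  have h2 := hT.dist_eq_dist_add_one_of_adj y hvw
  have h3 := dist_adj_cases hT v hxy
  have h4 := dist_adj_cases hT w hxy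
  by_cases hxw : x = w
  · subst hxw
    have : T.dist y v ≠ 0 := fun h => hy (hT.connected.dist_eq_zero_iff.1 h)
    rw [T.dist_self] at h4
    omega
  · obtain ⟨z, hz, hzd⟩ := exists_adj_dist_add_one hT.connected hxw
    have h5 := dist_adj_cases hT v hz
    have h6 := hT.dist_eq_dist_add_one_of_adj z hvw
    have := eq_of_adj_of_dist_add_one (u := v) hT hxy hz (by omega) (by omega)
    subst this
    omega

theorem supp_subset_branch (hT : T.IsTree) {v w : V} (hvw : T.Adj v w)
    (c : (T.induce {v}ᶜ).ConnectedComponent) (x : ({v}ᶜ : Set V)) (hx : x ∈ c.supp)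
    (hxb : (x : V) ∈ branch T v w) : Subtype.val '' c.supp ⊆ branch T v w := by
  rintro _ ⟨y, hy, rfl⟩
  obtain ⟨p⟩ := c.reachable_of_mem_supp hx hy
  clear hx hy
  induction p with
  | nil => exact hxb
  | @cons a b _ h q ih => exact ih (mem_branch_of_adj hT hvw h b.2 hxb)

/-- The geodesic from `x` to `w` stays in the branch and so avoids `v`. -/
theorem reachable_of_mem_branch (hT : T.IsTree) {v w : V} (hvw : T.Adj v w) (x : V)
    (hx : x ∈ branch T v w) (hxv : x ∈ ({v}ᶜ : Set V)) :
    (T.induce {v}ᶜ).Reachable ⟨w, hvw.ne'⟩ ⟨x, hxv⟩ := by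
  obtain ⟨k, hk⟩ : ∃ k, T.dist x w = k := ⟨_, rfl⟩
  induction k generalizing x with
  | zero =>
    obtain rfl := hT.connected.dist_eq_zero_iff.1 hk
    exact SimpleGraph.Reachable.refl _
  | succ k ih =>
    have hne : x ≠ w := by rintro rfl; simp at hk
    obtain ⟨z, hz, hzd⟩ := exists_adj_dist_add_one hT.connected hne
    have h5 := dist_adj_cases hT v hz
    have hzb : z ∈ branch T v w := by
      simp only [mem_branch] at hx ⊢
      omega
    have hzv : z ∈ ({v}ᶜ : Set V) := by
      rintro rfl
      simp [mem_branch] at hzb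
    refine (ih z hzb hzv (by omega)).trans ?_
    exact SimpleGraph.Adj.reachable hz.symm

/-- The components of `T - v` are the branches at the neighbours of `v`. -/
theorem isCentroid_iff_forall_branch [Fintype V] (hT : T.IsTree) (v : V) :
    IsCentroid T v ↔ ∀ w, T.Adj v w → (branch T v w).ncard ≤ Fintype.card V / 2 := by
  constructor
  · intro h w hw
    refine le_trans ?_ (h ((T.induce {v}ᶜ).connectedComponentMk ⟨w, hw.ne'⟩))
    rw [← Set.ncard_image_of_injective _ Subtype.val_injective]
    refine Set.ncard_le_ncard ?_ (Set.toFinite _)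
    intro x hx
    have hxv : x ∈ ({v}ᶜ : Set V) := by
      rintro rfl
      simp [mem_branch] at hx
    refine ⟨⟨x, hxv⟩, ?_, rfl⟩
    exact (SimpleGraph.ConnectedComponent.sound (reachable_of_mem_branch hT hw x hx hxv)).symm
  · intro h c
    obtain ⟨x, hx⟩ := c.nonempty_supp
    obtain ⟨w, hw, hwd⟩ := exists_adj_dist_add_one hT.connected (x := v) (u := x)
      (fun h => x.2 h.symm)
    refine le_trans ?_ (h w hw)
    rw [← Set.ncard_image_of_injective _ Subtype.val_injective]
    refine Set.ncard_le_ncard (supp_subset_branch hT hw c x hx ?_) (Set.toFinite _)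
    simp only [mem_branch]
    rw [T.dist_comm, T.dist_comm (u := (x : V)) (v := v)]
    omega

theorem isCentroid_iff_forall_degreeTransmission_le [Fintype V] (hT : T.IsTree) (v : V) :
    IsCentroid T v ↔ ∀ u, degreeTransmission T v ≤ degreeTransmission T u := by
  -- For natural numbers `b ≤ ⌊n / 2⌋` means `2b ≤ n`, so the rounding loses nothing.
  have hlocal : ∀ w, T.Adj v w → ((branch T v w).ncard ≤ Fintype.card V / 2 ↔
      transmission T v ≤ transmission T w) := by
    intro w hw
    rw [← sub_nonneg (b := transmission T v), transmission_sub_of_adj hT hw, sub_nonneg,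
      Nat.le_div_iff_mul_le two_pos, mul_comm]
    norm_cast
  have hglobal : ∀ u, degreeTransmission T v ≤ degreeTransmission T u ↔
      transmission T v ≤ transmission T u := by
    intro u
    have := degreeTransmission_sub hT u v
    constructor <;> intro h <;> linarith
  simp_rw [hglobal, isCentroid_iff_forall_branch hT]
  constructor
  · intro h
    exact transmission_le_of_forall_adj hT fun w hw => (hlocal w hw).1 (h w hw)
  · intro h w hw
    exact (hlocal w hw).2 (h w)

end Tree

end KemenyTree
namespace KemenyTree

/-! ### Kemeny's constant from a distance-like function. -/

section Kappa

variable {V : Type*} [Fintype V]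

open Classical in
theorem realDegree_eq_degree (G : SimpleGraph V) (i : V) : realDegree G i = G.degree i := by
  rw [realDegree, Finset.sum_boole, ← SimpleGraph.card_neighborFinset_eq_degree,
    SimpleGraph.neighborFinset_eq_filter]

theorem realDegree_nonneg (G : SimpleGraph V) (i : V) : 0 ≤ realDegree G i := by
  classical
  rw [realDegree_eq_degree]; positivity

open Classical in
theorem transitionMatrix_eq_ofReal (G : SimpleGraph V) (i l : V) (hi : 0 < realDegree G i) :
    transitionMatrix G i l = ENNReal.ofReal ((if G.Adj i l then 1 else 0) / realDegree G i) := by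
  rw [transitionMatrix]
  split_ifs with h
  · rw [one_div, ENNReal.ofReal_inv_of_pos hi, realDegree_eq_degree, ENNReal.ofReal_natCast]
  · simp

open Classical in
theorem stationary_eq_ofReal (G : SimpleGraph V) (hG : 0 < ∑ i, realDegree G i) (i : V) :
    stationary G i = ENNReal.ofReal (realDegree G i / ∑ l, realDegree G l) := by
  have h : ∑ l, realDegree G l = ((2 * G.edgeFinset.card : ℕ) : ℝ) := by
    rw [← G.sum_degrees_eq_twice_card_edges, Nat.cast_sum]
    exact Finset.sum_congr rfl fun l _ => realDegree_eq_degree G l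
  rw [stationary, ENNReal.ofReal_div_of_pos hG, h, realDegree_eq_degree, ENNReal.ofReal_natCast,
    ENNReal.ofReal_natCast]
  push_cast
  rfl

/-- The mean first passage times of a random walk, in terms of a function whose Laplacian is
that of the distance of a tree. -/
theorem meanFirstPassageTime_eq_of_laplacian [DecidableEq V] (G : SimpleGraph V) {ρ : V → V → ℝ}
    (hdiag : ∀ i, ρ i i = 0) (htri : ∀ i j x, ρ i x ≤ ρ i j + ρ j x)
    (hdeg : ∀ i, 0 < realDegree G i)
    (hlap : ∀ x i, laplacian G (fun l => ρ l x) i =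
      2 - realDegree G i - 2 * (if i = x then 1 else 0)) (i j : V) :
    meanFirstPassageTime (transitionMatrix G) i j =
      ENNReal.ofReal (∑ x, realDegree G x * (ρ i j + ρ j x - ρ i x) / 2) := by
  classical
  set g : V → ℝ := fun i => ∑ x, realDegree G x * (ρ i j + ρ j x - ρ i x) / 2 with hg
  have hg0 : ∀ i, 0 ≤ g i := fun i => Finset.sum_nonneg fun x _ =>
    div_nonneg (mul_nonneg (hdeg x).le (by linarith [htri i j x])) two_pos.le
  -- The Laplacian kills the constant `ρ j x`, and the terms `2 - deg i` cancel in the difference.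
  -- What remains for `i ≠ j` is a point mass of weight 2 at `x = i`.
  have hlapg : ∀ i, i ≠ j → laplacian G g i = realDegree G i := by
    intro i hij
    have h1 : laplacian G g i = ∑ x, realDegree G x *
        (laplacian G (fun l => ρ l j) i - laplacian G (fun l => ρ l x) i) / 2 := by
      simp only [laplacian, hg]
      simp_rw [← Finset.sum_sub_distrib, Finset.mul_sum, Finset.sum_div]
      rw [Finset.sum_comm]
      refine Finset.sum_congr rfl fun l _ => ?_
      split_ifs
      · exact Finset.sum_congr rfl fun x _ => by ring
      · simp
    rw [h1]
    simp only [hlap, hij, if_false]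
    rw [Finset.sum_eq_single i]
    · simp
    · intro x _ hx
      simp [hx.symm]
    · simp
  refine meanFirstPassageTime_eq_of_step (g := fun i => ENNReal.ofReal (g i)) ?_ ?_ ?_ ?_ i
  · intro i _
    simp_rw [transitionMatrix_eq_ofReal G i _ (hdeg i)]
    rw [← ENNReal.ofReal_sum_of_nonneg, ← Finset.sum_div]
    · rw [← realDegree, div_self (hdeg i).ne', ENNReal.ofReal_one]
    · intro l _
      have := hdeg i
      positivity
  · exact fun i => ENNReal.ofReal_ne_top
  · simp [hg, hdiag]
  · intro i hij
    have hnn : ∀ l, 0 ≤ (if G.Adj i l then 1 else 0) / realDegree G i := by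
      intro l
      have := hdeg i
      positivity
    simp_rw [transitionMatrix_eq_ofReal G i _ (hdeg i), ← ENNReal.ofReal_mul (hnn _)]
    rw [← ENNReal.ofReal_sum_of_nonneg fun l _ => mul_nonneg (hnn l) (hg0 l),
      ← ENNReal.ofReal_one, ← ENNReal.ofReal_add zero_le_one
        (Finset.sum_nonneg fun l _ => mul_nonneg (hnn l) (hg0 l))]
    congr 1
    -- The Laplacian is `deg * (g - P g)`, so `hlapg` is the first-step equation multiplied by the
    -- degree.
    have h2 : laplacian G g i =
        realDegree G i * g i - realDegree G i *
          ∑ l, (if G.Adj i l then 1 else 0) / realDegree G i * g l := by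
      have hd : realDegree G i * g i = ∑ l, (if G.Adj i l then 1 else 0) * g i := by
        rw [realDegree, Finset.sum_mul]
      rw [hd, laplacian, Finset.mul_sum, ← Finset.sum_sub_distrib]
      refine Finset.sum_congr rfl fun l _ => ?_
      have := (hdeg i).ne'
      split_ifs
      · field_simp
      · simp
    rw [hlapg i hij] at h2
    have := (hdeg i).ne'
    apply mul_left_cancel₀ this
    linarith

/-- Weighted by the degrees and summed, each of the three terms of the passage-time formula gives `S
* K`; two enter with a plus sign and one with a minus. -/
theorem kappa_eq_of_laplacian [DecidableEq V] [Nonempty V] (G : SimpleGraph V) {ρ : V → V → ℝ}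
    (hdiag : ∀ i, ρ i i = 0)
    (htri : ∀ i j x, ρ i x ≤ ρ i j + ρ j x) (hdeg : ∀ i, 0 < realDegree G i)
    (hlap : ∀ x i, laplacian G (fun l => ρ l x) i =
      2 - realDegree G i - 2 * (if i = x then 1 else 0)) :
    kappa G = ENNReal.ofReal ((∑ i, ∑ j, realDegree G i * realDegree G j * ρ i j) /
      (2 * ∑ i, realDegree G i)) := by
  have hS : 0 < ∑ i, realDegree G i := Finset.sum_pos (fun i _ => hdeg i) Finset.univ_nonempty
  set S := ∑ i, realDegree G i with hSdef
  set K := ∑ i, ∑ j, realDegree G i * realDegree G j * ρ i j with hK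
  have hm := meanFirstPassageTime_eq_of_laplacian G hdiag htri hdeg hlap
  have hm0 : ∀ i j, 0 ≤ ∑ x, realDegree G x * (ρ i j + ρ j x - ρ i x) / 2 :=
    fun i j => Finset.sum_nonneg fun x _ =>
      div_nonneg (mul_nonneg (hdeg x).le (by linarith [htri i j x])) two_pos.le
  have hterm : ∀ i j, stationary G i * meanFirstPassageTime (transitionMatrix G) i j *
      stationary G j = ENNReal.ofReal (realDegree G i / S *
        (∑ x, realDegree G x * (ρ i j + ρ j x - ρ i x) / 2) * (realDegree G j / S)) := by
    intro i j
    have := (hdeg i).le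
    rw [stationary_eq_ofReal G hS, stationary_eq_ofReal G hS, hm,
      ← ENNReal.ofReal_mul (by positivity), ← ENNReal.ofReal_mul (mul_nonneg (by positivity) (hm0 i j))]
  have hnn : ∀ i j, 0 ≤ realDegree G i / S *
        (∑ x, realDegree G x * (ρ i j + ρ j x - ρ i x) / 2) * (realDegree G j / S) :=
    fun i j => mul_nonneg (mul_nonneg (div_nonneg (hdeg i).le hS.le) (hm0 i j))
      (div_nonneg (hdeg j).le hS.le)
  -- The passage time from a state to itself is zero, visits at time 0 being counted, so the
  -- diagonal may be included.
  have herase : ∀ i, ∑ j ∈ Finset.univ.erase i, stationary G i *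
      meanFirstPassageTime (transitionMatrix G) i j * stationary G j =
      ∑ j, stationary G i * meanFirstPassageTime (transitionMatrix G) i j * stationary G j := by
    intro i
    refine Finset.sum_subset (Finset.subset_univ _) fun j _ hj => ?_
    obtain rfl : j = i := by simpa using hj
    rw [hm]
    simp [hdiag]
  have hκ : kappa G = ∑ i, ∑ j, stationary G i *
      meanFirstPassageTime (transitionMatrix G) i j * stationary G j := by
    rw [← Finset.sum_congr rfl fun i _ => herase i]
    unfold kappa kemenyConstant
    convert rfl
  rw [hκ]
  simp_rw [hterm]
  rw [Finset.sum_congr rfl fun i _ => (ENNReal.ofReal_sum_of_nonneg fun j _ => hnn i j).symm,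
    ← ENNReal.ofReal_sum_of_nonneg fun i _ => Finset.sum_nonneg fun j _ => hnn i j]
  congr 1
  have hsplit : ∀ i j, realDegree G i / S *
      (∑ x, realDegree G x * (ρ i j + ρ j x - ρ i x) / 2) * (realDegree G j / S) =
      (S * (realDegree G i * realDegree G j * ρ i j) +
        realDegree G i * (∑ x, realDegree G j * realDegree G x * ρ j x) -
        realDegree G j * (∑ x, realDegree G i * realDegree G x * ρ i x)) / (2 * S ^ 2) := by
    intro i j
    have h1 : ∑ x, realDegree G x * (ρ i j + ρ j x - ρ i x) / 2 =
        (S * ρ i j + (∑ x, realDegree G x * ρ j x) - ∑ x, realDegree G x * ρ i x) / 2 := by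
      rw [hSdef, Finset.sum_mul, ← Finset.sum_add_distrib, ← Finset.sum_sub_distrib,
        Finset.sum_div]
      exact Finset.sum_congr rfl fun x _ => by ring
    rw [h1]
    simp_rw [mul_assoc (realDegree G _), ← Finset.mul_sum]
    field_simp
  simp_rw [hsplit]
  rw [← Finset.sum_congr rfl fun i _ => Finset.sum_div _ _ _, ← Finset.sum_div]
  simp only [Finset.sum_sub_distrib, Finset.sum_add_distrib, ← Finset.mul_sum, ← Finset.sum_mul]
  rw [← hK, ← hSdef]
  field_simp
  ring

end Kappa

/-! ### Two trees joined by a bridge. -/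

section Join

variable {V₁ V₂ : Type*} {T₁ : SimpleGraph V₁} {T₂ : SimpleGraph V₂} {v₁ : V₁} {v₂ : V₂}

/-- The distance in `joinByEdge T₁ T₂ v₁ v₂` in terms of the distances in `T₁` and `T₂`. -/
noncomputable def joinDist (T₁ : SimpleGraph V₁) (T₂ : SimpleGraph V₂) (v₁ : V₁) (v₂ : V₂) :
    V₁ ⊕ V₂ → V₁ ⊕ V₂ → ℝ
  | Sum.inl x, Sum.inl y => T₁.dist x y
  | Sum.inl x, Sum.inr y => T₁.dist x v₁ + 1 + T₂.dist y v₂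
  | Sum.inr x, Sum.inl y => T₁.dist y v₁ + 1 + T₂.dist x v₂
  | Sum.inr x, Sum.inr y => T₂.dist x y

theorem joinDist_self (i : V₁ ⊕ V₂) : joinDist T₁ T₂ v₁ v₂ i i = 0 := by
  cases i <;> simp [joinDist]

theorem joinDist_triangle (h₁ : T₁.Connected) (h₂ : T₂.Connected) (i j x : V₁ ⊕ V₂) :
    joinDist T₁ T₂ v₁ v₂ i x ≤ joinDist T₁ T₂ v₁ v₂ i j + joinDist T₁ T₂ v₁ v₂ j x := by
  rcases i with i | i <;> rcases j with j | j <;> rcases x with x | x <;>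
    simp only [joinDist] <;> norm_cast
  · exact h₁.dist_triangle
  · have := h₁.dist_triangle (u := i) (v := j) (w := v₁); omega
  · have := h₁.dist_triangle (u := i) (v := v₁) (w := x)
    rw [T₁.dist_comm (u := v₁)] at this; omega
  · have := h₂.dist_triangle (u := x) (v := j) (w := v₂)
    rw [T₂.dist_comm (u := x) (v := j)] at this; omega
  · have := h₁.dist_triangle (u := x) (v := j) (w := v₁)
    rw [T₁.dist_comm (u := x) (v := j)] at this; omega
  · have := h₂.dist_triangle (u := i) (v := v₂) (w := x)
    rw [T₂.dist_comm (u := v₂)] at this; omega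
  · have := h₂.dist_triangle (u := i) (v := j) (w := v₂); omega
  · exact h₂.dist_triangle

theorem joinByEdge_adj_inl_inl (x y : V₁) :
    (joinByEdge T₁ T₂ v₁ v₂).Adj (Sum.inl x) (Sum.inl y) ↔ T₁.Adj x y := by
  simp [joinByEdge, SimpleGraph.edge_adj]

theorem joinByEdge_adj_inr_inr (x y : V₂) :
    (joinByEdge T₁ T₂ v₁ v₂).Adj (Sum.inr x) (Sum.inr y) ↔ T₂.Adj x y := by
  simp [joinByEdge, SimpleGraph.edge_adj]

theorem joinByEdge_adj_inl_inr (x : V₁) (y : V₂) :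
    (joinByEdge T₁ T₂ v₁ v₂).Adj (Sum.inl x) (Sum.inr y) ↔ x = v₁ ∧ y = v₂ := by
  simp [joinByEdge, SimpleGraph.edge_adj, eq_comm]

theorem joinByEdge_adj_inr_inl (x : V₁) (y : V₂) :
    (joinByEdge T₁ T₂ v₁ v₂).Adj (Sum.inr y) (Sum.inl x) ↔ x = v₁ ∧ y = v₂ := by
  rw [SimpleGraph.adj_comm, joinByEdge_adj_inl_inr]

variable [Fintype V₁] [Fintype V₂] [DecidableEq V₁] [DecidableEq V₂]

theorem laplacian_joinByEdge_inl (f : V₁ ⊕ V₂ → ℝ) (x : V₁) :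
    laplacian (joinByEdge T₁ T₂ v₁ v₂) f (Sum.inl x) =
      laplacian T₁ (f ∘ Sum.inl) x +
        if x = v₁ then f (Sum.inl v₁) - f (Sum.inr v₂) else 0 := by
  classical
  rw [laplacian, Fintype.sum_sum_type, laplacian]
  simp only [joinByEdge_adj_inl_inl, joinByEdge_adj_inl_inr, Function.comp]
  congr 1
  by_cases h : x = v₁ <;> simp [h]

theorem laplacian_joinByEdge_inr (f : V₁ ⊕ V₂ → ℝ) (y : V₂) :
    laplacian (joinByEdge T₁ T₂ v₁ v₂) f (Sum.inr y) =
      laplacian T₂ (f ∘ Sum.inr) y +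
        if y = v₂ then f (Sum.inr v₂) - f (Sum.inl v₁) else 0 := by
  classical
  rw [laplacian, Fintype.sum_sum_type, laplacian, add_comm]
  simp only [joinByEdge_adj_inr_inr, joinByEdge_adj_inr_inl, Function.comp]
  congr 1
  by_cases h : y = v₂ <;> simp [h]

theorem realDegree_joinByEdge_inl (x : V₁) :
    realDegree (joinByEdge T₁ T₂ v₁ v₂) (Sum.inl x) =
      realDegree T₁ x + if x = v₁ then 1 else 0 := by
  classical
  rw [realDegree, Fintype.sum_sum_type, realDegree]
  simp only [joinByEdge_adj_inl_inl, joinByEdge_adj_inl_inr]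
  congr 1
  by_cases h : x = v₁ <;> simp [h]

theorem realDegree_joinByEdge_inr (y : V₂) :
    realDegree (joinByEdge T₁ T₂ v₁ v₂) (Sum.inr y) =
      realDegree T₂ y + if y = v₂ then 1 else 0 := by
  classical
  rw [realDegree, Fintype.sum_sum_type, realDegree, add_comm]
  simp only [joinByEdge_adj_inr_inr, joinByEdge_adj_inr_inl]
  congr 1
  by_cases h : y = v₂ <;> simp [h]

theorem laplacian_add_const {V : Type*} [Fintype V] (G : SimpleGraph V) (f : V → ℝ) (c : ℝ) :
    laplacian G (fun l => f l + c) = laplacian G f := by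
  funext i
  simp [laplacian]

/-- At its endpoints the bridge contributes `-1` on the side of the target `x`, matching the raised
degree. On the other side the function is the distance to the endpoint plus a constant, and the
bridge's `+1` turns `-deg` into `2 - (deg + 1)`. -/
theorem laplacian_joinDist (h₁ : T₁.IsTree) (h₂ : T₂.IsTree) (x i : V₁ ⊕ V₂) :
    laplacian (joinByEdge T₁ T₂ v₁ v₂) (fun l => joinDist T₁ T₂ v₁ v₂ l x) i =
      2 - realDegree (joinByEdge T₁ T₂ v₁ v₂) i - 2 * (if i = x then 1 else 0) := by
  rcases i with i | i
  · rw [laplacian_joinByEdge_inl, realDegree_joinByEdge_inl]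
    rcases x with x | x
    · have : ((fun l => joinDist T₁ T₂ v₁ v₂ l (Sum.inl x)) ∘ Sum.inl) =
          fun l => (T₁.dist l x : ℝ) := rfl
      rw [this, laplacian_dist h₁]
      simp only [joinDist, Sum.inl.injEq, T₁.dist_comm (u := x), T₂.dist_self]
      split_ifs <;> push_cast <;> ring
    · have : ((fun l => joinDist T₁ T₂ v₁ v₂ l (Sum.inr x)) ∘ Sum.inl) =
          fun l => (T₁.dist l v₁ : ℝ) + (1 + T₂.dist x v₂) := by
        funext l; simp [joinDist, add_assoc]
      rw [this, laplacian_add_const, laplacian_dist h₁]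
      simp only [joinDist, T₁.dist_self, T₂.dist_comm (u := v₂), reduceCtorEq, if_false]
      split_ifs <;> push_cast <;> ring
  · rw [laplacian_joinByEdge_inr, realDegree_joinByEdge_inr]
    rcases x with x | x
    · have : ((fun l => joinDist T₁ T₂ v₁ v₂ l (Sum.inl x)) ∘ Sum.inr) =
          fun l => (T₂.dist l v₂ : ℝ) + (T₁.dist x v₁ + 1) := by
        funext l; simp [joinDist, add_comm]
      rw [this, laplacian_add_const, laplacian_dist h₂]
      simp only [joinDist, T₂.dist_self, T₁.dist_comm (u := v₁), reduceCtorEq, if_false]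
      split_ifs <;> push_cast <;> ring
    · have : ((fun l => joinDist T₁ T₂ v₁ v₂ l (Sum.inr x)) ∘ Sum.inr) =
          fun l => (T₂.dist l x : ℝ) := rfl
      rw [this, laplacian_dist h₂]
      simp only [joinDist, Sum.inr.injEq, T₂.dist_comm (u := x), T₁.dist_self]
      split_ifs <;> push_cast <;> ring

/-- The added 1 is essential for a one-vertex tree, whose only degree is 0. -/
theorem realDegree_add_pos {V : Type*} [Fintype V] [DecidableEq V] {T : SimpleGraph V}
    (hT : T.IsTree) (v i : V) : 0 < realDegree T i + if i = v then 1 else 0 := by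
  classical
  have h0 := realDegree_nonneg T i
  split_ifs with h
  · linarith
  · obtain ⟨w, hw, -⟩ := exists_adj_dist_add_one hT.connected h
    rw [add_zero, realDegree_eq_degree, Nat.cast_pos]
    exact (T.degree_pos_iff_exists_adj i).2 ⟨w, hw⟩

theorem realDegree_joinByEdge_pos (h₁ : T₁.IsTree) (h₂ : T₂.IsTree) (i : V₁ ⊕ V₂) :
    0 < realDegree (joinByEdge T₁ T₂ v₁ v₂) i := by
  rcases i with i | i
  · rw [realDegree_joinByEdge_inl]
    exact realDegree_add_pos h₁ v₁ i
  · rw [realDegree_joinByEdge_inr]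
    exact realDegree_add_pos h₂ v₂ i

theorem sum_realDegree_joinByEdge_mul (f : V₁ ⊕ V₂ → ℝ) :
    ∑ i, realDegree (joinByEdge T₁ T₂ v₁ v₂) i * f i =
      ∑ x, realDegree T₁ x * f (Sum.inl x) + f (Sum.inl v₁) +
        (∑ y, realDegree T₂ y * f (Sum.inr y) + f (Sum.inr v₂)) := by
  simp only [Fintype.sum_sum_type, realDegree_joinByEdge_inl, realDegree_joinByEdge_inr,
    add_mul, Finset.sum_add_distrib, ite_mul, one_mul, zero_mul, Finset.sum_ite_eq',
    Finset.mem_univ, if_true]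

theorem sum_realDegree_joinByEdge :
    ∑ i, realDegree (joinByEdge T₁ T₂ v₁ v₂) i =
      ∑ x, realDegree T₁ x + ∑ y, realDegree T₂ y + 2 := by
  have h := sum_realDegree_joinByEdge_mul (T₁ := T₁) (T₂ := T₂) (v₁ := v₁) (v₂ := v₂) fun _ => 1
  simp only [mul_one] at h
  rw [h]
  ring

theorem sum_realDegree_mul_joinDist_inl (x : V₁) :
    ∑ j, realDegree (joinByEdge T₁ T₂ v₁ v₂) j * joinDist T₁ T₂ v₁ v₂ (Sum.inl x) j =
      degreeTransmission T₁ x + (T₁.dist x v₁ : ℝ) * ((∑ y, realDegree T₂ y) + 2) +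
        ((∑ y, realDegree T₂ y) + 1) + degreeTransmission T₂ v₂ := by
  rw [sum_realDegree_joinByEdge_mul]
  simp only [joinDist, mul_add, Finset.sum_add_distrib, ← Finset.sum_mul, T₂.dist_self,
    degreeTransmission, T₁.dist_comm (u := x), mul_one, Nat.cast_zero]
  ring

theorem sum_realDegree_mul_joinDist_inr (y : V₂) :
    ∑ j, realDegree (joinByEdge T₁ T₂ v₁ v₂) j * joinDist T₁ T₂ v₁ v₂ (Sum.inr y) j =
      degreeTransmission T₂ y + (T₂.dist y v₂ : ℝ) * ((∑ x, realDegree T₁ x) + 2) +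
        ((∑ x, realDegree T₁ x) + 1) + degreeTransmission T₁ v₁ := by
  rw [sum_realDegree_joinByEdge_mul]
  simp only [joinDist, mul_add, Finset.sum_add_distrib, ← Finset.sum_mul, T₁.dist_self,
    degreeTransmission, T₂.dist_comm (u := y), mul_one, Nat.cast_zero]
  ring

/-- In the coefficient `S₂ + 2` of `D₁(v₁)`, the cross pairs give `S₂ + 1`, the degree sum of the
other side with the bridge, and the extra degree of `v₁` inside `T₁` gives 1. -/
theorem sum_realDegree_mul_realDegree_mul_joinDist :
    ∑ i, ∑ j, realDegree (joinByEdge T₁ T₂ v₁ v₂) i * realDegree (joinByEdge T₁ T₂ v₁ v₂) j *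
        joinDist T₁ T₂ v₁ v₂ i j =
      (∑ x, realDegree T₁ x * degreeTransmission T₁ x) +
      (∑ y, realDegree T₂ y * degreeTransmission T₂ y) +
      2 * ((∑ x, realDegree T₁ x) + 1) * ((∑ y, realDegree T₂ y) + 1) +
      2 * ((∑ y, realDegree T₂ y) + 2) * degreeTransmission T₁ v₁ +
      2 * ((∑ x, realDegree T₁ x) + 2) * degreeTransmission T₂ v₂ := by
  simp_rw [mul_assoc (realDegree _ _) (realDegree _ _) (joinDist _ _ _ _ _ _), ← Finset.mul_sum]
  rw [sum_realDegree_joinByEdge_mul]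
  simp_rw [sum_realDegree_mul_joinDist_inl, sum_realDegree_mul_joinDist_inr, mul_add,
    Finset.sum_add_distrib, ← mul_assoc, ← Finset.sum_mul]
  rw [← degreeTransmission, ← degreeTransmission, T₁.dist_self, T₂.dist_self]
  push_cast
  ring

theorem kappa_joinByEdge (h₁ : T₁.IsTree) (h₂ : T₂.IsTree) (v₁ : V₁) (v₂ : V₂) :
    kappa (joinByEdge T₁ T₂ v₁ v₂) = ENNReal.ofReal
      (((∑ x, realDegree T₁ x * degreeTransmission T₁ x) +
      (∑ y, realDegree T₂ y * degreeTransmission T₂ y) +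
      2 * ((∑ x, realDegree T₁ x) + 1) * ((∑ y, realDegree T₂ y) + 1) +
      2 * ((∑ y, realDegree T₂ y) + 2) * degreeTransmission T₁ v₁ +
      2 * ((∑ x, realDegree T₁ x) + 2) * degreeTransmission T₂ v₂) /
      (2 * (∑ x, realDegree T₁ x + ∑ y, realDegree T₂ y + 2))) := by
  have : Nonempty (V₁ ⊕ V₂) := ⟨Sum.inl v₁⟩
  rw [kappa_eq_of_laplacian _ joinDist_self
    (joinDist_triangle h₁.connected h₂.connected) (realDegree_joinByEdge_pos h₁ h₂)
    (laplacian_joinDist h₁ h₂), sum_realDegree_mul_realDegree_mul_joinDist,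
    sum_realDegree_joinByEdge]

theorem degreeTransmission_nonneg {V : Type*} [Fintype V] (T : SimpleGraph V) (v : V) :
    0 ≤ degreeTransmission T v :=
  Finset.sum_nonneg fun i _ => mul_nonneg (realDegree_nonneg T i) (Nat.cast_nonneg _)

theorem kappa_joinByEdge_le_iff (h₁ : T₁.IsTree) (h₂ : T₂.IsTree) (v₁ u₁ : V₁) (v₂ u₂ : V₂) :
    kappa (joinByEdge T₁ T₂ v₁ v₂) ≤ kappa (joinByEdge T₁ T₂ u₁ u₂) ↔
      ((∑ y, realDegree T₂ y) + 2) * degreeTransmission T₁ v₁ +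
        ((∑ x, realDegree T₁ x) + 2) * degreeTransmission T₂ v₂ ≤
      ((∑ y, realDegree T₂ y) + 2) * degreeTransmission T₁ u₁ +
        ((∑ x, realDegree T₁ x) + 2) * degreeTransmission T₂ u₂ := by
  have hS₁ : 0 ≤ ∑ x, realDegree T₁ x := Finset.sum_nonneg fun x _ => realDegree_nonneg T₁ x
  have hS₂ : 0 ≤ ∑ y, realDegree T₂ y := Finset.sum_nonneg fun y _ => realDegree_nonneg T₂ y
  have hK₁ : 0 ≤ ∑ x, realDegree T₁ x * degreeTransmission T₁ x := Finset.sum_nonneg fun x _ =>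
    mul_nonneg (realDegree_nonneg T₁ x) (degreeTransmission_nonneg T₁ x)
  have hK₂ : 0 ≤ ∑ y, realDegree T₂ y * degreeTransmission T₂ y := Finset.sum_nonneg fun y _ =>
    mul_nonneg (realDegree_nonneg T₂ y) (degreeTransmission_nonneg T₂ y)
  have hu₁ := degreeTransmission_nonneg T₁ u₁
  have hu₂ := degreeTransmission_nonneg T₂ u₂
  rw [kappa_joinByEdge h₁ h₂, kappa_joinByEdge h₁ h₂, ENNReal.ofReal_le_ofReal_iff (by positivity),
    div_le_div_iff_of_pos_right (by positivity)]
  constructor <;> intro h <;> linarith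

end Join

end KemenyTree

/-! ### The separated minimisation. -/

theorem corollary2p7 {V₁ V₂ : Type*} [Fintype V₁] [Fintype V₂]
    (T₁ : SimpleGraph V₁) (T₂ : SimpleGraph V₂) (hT₁ : T₁.IsTree) (hT₂ : T₂.IsTree)
    (v₁ : V₁) (v₂ : V₂) :
    (∀ (u₁ : V₁) (u₂ : V₂),
        KemenyTree.kappa (KemenyTree.joinByEdge T₁ T₂ v₁ v₂) ≤
          KemenyTree.kappa (KemenyTree.joinByEdge T₁ T₂ u₁ u₂)) ↔
      KemenyTree.IsCentroid T₁ v₁ ∧ KemenyTree.IsCentroid T₂ v₂ := by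
  classical
  have hS₁ : 0 < ∑ x, KemenyTree.realDegree T₁ x + 2 :=
    add_pos_of_nonneg_of_pos
      (Finset.sum_nonneg fun x _ => KemenyTree.realDegree_nonneg T₁ x) two_pos
  have hS₂ : 0 < ∑ y, KemenyTree.realDegree T₂ y + 2 :=
    add_pos_of_nonneg_of_pos
      (Finset.sum_nonneg fun y _ => KemenyTree.realDegree_nonneg T₂ y) two_pos
  rw [KemenyTree.isCentroid_iff_forall_degreeTransmission_le hT₁,
    KemenyTree.isCentroid_iff_forall_degreeTransmission_le hT₂]
  simp_rw [KemenyTree.kappa_joinByEdge_le_iff hT₁ hT₂]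
  constructor
  · intro h
    refine ⟨fun u₁ => ?_, fun u₂ => ?_⟩
    -- Varying one endpoint with the other fixed isolates one summand.
    · exact le_of_mul_le_mul_left (le_of_add_le_add_right (h u₁ v₂)) hS₂
    · exact le_of_mul_le_mul_left (le_of_add_le_add_left (h v₁ u₂)) hS₁
  · rintro ⟨h1, h2⟩ u₁ u₂
    exact add_le_add (mul_le_mul_of_nonneg_left (h1 u₁) hS₂.le)
      (mul_le_mul_of_nonneg_left (h2 u₂) hS₁.le)
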